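/- Let $G$ be a locally compact abelian (Hausdorff) group with Haar measure $\mu_G$, let $U$ be a (weakly continuous) unitary representation of $G$ on a separable Hilbert space $\mathcal H$, and let $\phi\in\mathcal H$ be such that $\{U(t)\phi\}_{t\in G}$ is a continuous frame for $\mathcal H$ with respect to $(G,\mu_G)$. Let $H$ be a countable discrete subgroup of $G$ and let $\Phi=\{\varphi_1,\dots,\varphi_N\}\subset\mathcal H$ be such that $\{U(h)\varphi_n\}_{h\in H,\,1\le n\le N}$ is a Riesz sequence in $\mathcal H$. Put $$\mathcal H_\Phi=\Big\{\sum_{n=1}^N\sum_{h\in H}x_n(h)U(h)\varphi_n : x_n\in\ell^2(H)\Big\},\qquad \mathcal H_{U,\phi,\Phi}=\{F_f : f\in\mathcal H_\Phi\}\subset L^2(G),\quad F_f(s)=\langle f,U(s)\phi\rangle .$$ Let $R$ be a subgroup of $H$ of finite index $L$, let $h_1,\dots,h_L\in H$ be representatives of the cosets of $R$, and let $\varphi_{nl}=U(h_l)\varphi_n$. Let $A=[a_{m,nl}]$ be an $M\times NL$ matrix with entries in $\ell^2(R)$ whose entrywise Fourier transform $\widehat A$ has entries in $L^\infty(\widehat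 R)$ and satisfies $\operatorname{ess\,inf}_{\xi\in\widehat R}\det[\widehat A(\xi)^*\widehat A(\xi)]>0$. For $F=F_f\in\mathcal H_{U,\phi,\Phi}$, write $f=\sum_{n=1}^N\sum_{l=1}^L\sum_{r\in R}x_{nl}(r)U(r)\varphi_{nl}$ with $x_{nl}\in\ell^2(R)$, and define its generalized samples at $R$ by $$\mathcal L_mF(r)=\sum_{n=1}^N\sum_{l=1}^L\sum_{r'\in R}a_{m,nl}(r-r')\,x_{nl}(r'),\qquad r\in R,\ m=1,\dots,M .$$ Then $M\ge NL$, and there exist $M$ functions $S_1,\dots,S_M\in\mathcal H_{U,\phi,\Phi}$ such that, for every $F\in\mathcal H_{U,\phi,\Phi}$, $$F(s)=\sum_{m=1}^M\sum_{r\in R}\mathcal L_mF(r)\,S_m(s-r),\qquad s\in G,$$ where the series converges absolutely at each point of $G$, uniformly on $G$ (as the net of its finite partial sums), and in the norm of $L^2(G)$. Moreover, $\{S_m(\cdot-r)\}_{r\in R,\,1\le m\le M}$ is a frame for $\mathcal H_{U,\phi,\Phi}$ with respect to the inner product of $L^2(G)$. -/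

import Mathlib

open MeasureTheory Filter Topology
open scoped ENNReal ComplexConjugate Matrix

namespace UnitarySampling

noncomputable section

/-! ## Fourier analysis on a discrete abelian group -/

/-- The Hilbert space `ℓ²(Γ)` of square-summable complex functions on `Γ`. -/
abbrev EllTwo (Γ : Type*) : Type _ := lp (fun _ : Γ => ℂ) 2

/-- The group of (continuous) characters `Γ → 𝕋` of an additive topological group, with the
compact-open topology; it is compact when `Γ` is discrete. -/
abbrev DualGroup (Γ : Type*) [AddCommGroup Γ] [TopologicalSpace Γ] : Type _ :=
  PontryaginDual (Multiplicative Γ)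

section Fourier

variable {Γ : Type*} [AddCommGroup Γ] [TopologicalSpace Γ]

instance instMeasurableSpaceDualGroup : MeasurableSpace (DualGroup Γ) := borel _

instance instBorelSpaceDualGroup : BorelSpace (DualGroup Γ) := ⟨rfl⟩

/-- The pairing `(h, ξ) = ξ(h) ∈ 𝕋 ⊆ ℂ`. -/
def pairing (h : Γ) (ξ : DualGroup Γ) : ℂ := (ξ (Multiplicative.ofAdd h) : ℂ)

theorem continuous_pairing [DiscreteTopology Γ] (h : Γ) :
    Continuous (fun ξ : DualGroup Γ => pairing h ξ) := by
  have h1 : Continuous (fun f : Multiplicative Γ →ₜ* Circle =>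
      f.toContinuousMap (Multiplicative.ofAdd h)) :=
    (ContinuousEvalConst.continuous_eval_const (F := C(Multiplicative Γ, Circle))
      (Multiplicative.ofAdd h)).comp
      (ContinuousMonoidHom.isInducing_toContinuousMap _ _).continuous
  exact continuous_subtype_val.comp h1

/-- The continuous function `ξ ↦ conj (h, ξ) = (-h, ξ)` on the dual group. -/
def conjCharacter [DiscreteTopology Γ] (h : Γ) : C(DualGroup Γ, ℂ) :=
  ⟨fun ξ => conj (pairing h ξ), Complex.continuous_conj.comp (continuous_pairing h)⟩

/-- Haar measure of the compact dual group of a discrete group, normalized to total mass one. -/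
def dualHaar (Γ : Type*) [AddCommGroup Γ] [TopologicalSpace Γ] [DiscreteTopology Γ] :
    Measure (DualGroup Γ) :=
  Measure.haarMeasure ⊤

instance instIsProbabilityMeasureDualHaar [DiscreteTopology Γ] :
    IsProbabilityMeasure (dualHaar Γ) :=
  ⟨by
    have h := Measure.haarMeasure_self (K₀ := (⊤ : TopologicalSpace.PositiveCompacts (DualGroup Γ)))
    rwa [TopologicalSpace.PositiveCompacts.coe_top] at h⟩

instance instIsHaarMeasureDualHaar [DiscreteTopology Γ] : (dualHaar Γ).IsHaarMeasure := by
  unfold dualHaar; infer_instance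

/-- Characters separate the points of a discrete abelian group. -/
theorem exists_pairing_ne_one [DiscreteTopology Γ] {h : Γ} (hh : h ≠ 0) :
    ∃ ξ : DualGroup Γ, pairing h ξ ≠ 1 := by
  obtain ⟨c, hc⟩ := CharacterModule.exists_character_apply_ne_zero_of_ne_zero hh
  let g : ℚ →+ Additive Circle :=
    { toFun := fun q => Additive.ofMul (Circle.exp (2 * Real.pi * (q : ℝ)))
      map_zero' := by simp
      map_add' := fun p q => by
        rw [← ofMul_mul, ← Circle.exp_add]
        push_cast
        ring_nf }
  have hg1 : ∀ q : ℚ, g q = 0 ↔ ∃ n : ℤ, (n : ℚ) = q := fun q => by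
    have h1 : g q = 0 ↔ Circle.exp (2 * Real.pi * (q : ℝ)) = 1 := Iff.rfl
    rw [h1, Circle.exp_eq_one]
    refine exists_congr fun n => ?_
    have hpi := Real.pi_pos.ne'
    constructor
    · intro h2
      have h3 : (q : ℝ) = n := by
        have : (2 * Real.pi) * (q : ℝ) = (2 * Real.pi) * n := by rw [h2]; ring
        exact mul_left_cancel₀ (by positivity) this
      exact_mod_cast h3.symm
    · rintro rfl
      push_cast
      ring
  have hg : AddSubgroup.zmultiples (1 : ℚ) ≤ g.ker := by
    rintro q ⟨n, rfl⟩
    exact (hg1 _).2 ⟨n, by simp⟩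
  let g' : AddCircle (1 : ℚ) →+ Additive Circle := QuotientAddGroup.lift _ g hg
  let c' : Γ →+ AddCircle (1 : ℚ) := c
  let χ : Multiplicative Γ →* Circle := AddMonoidHom.toMultiplicativeLeft (g'.comp c')
  refine ⟨(⟨χ, continuous_of_discreteTopology⟩ : Multiplicative Γ →ₜ* Circle), fun h1 => hc ?_⟩
  have h2 : χ (Multiplicative.ofAdd h) = 1 := by
    ext
    exact h1
  have h3 : g' (c' h) = 0 := h2
  change c' h = 0
  obtain ⟨q, hq⟩ := QuotientAddGroup.mk_surjective (c' h)
  rw [← hq] at h3 ⊢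
  obtain ⟨n, rfl⟩ := (hg1 q).1 h3
  rw [QuotientAddGroup.eq_zero_iff]
  exact ⟨n, by simp⟩

/-- The conjugate characters, as elements of `L²` of the dual group. -/
def characterL2 [DiscreteTopology Γ] (h : Γ) : Lp ℂ 2 (dualHaar Γ) :=
  ContinuousMap.toLp 2 (dualHaar Γ) ℂ (conjCharacter h)

theorem orthonormal_characterL2 [DiscreteTopology Γ] :
    Orthonormal ℂ (characterL2 : Γ → Lp ℂ 2 (dualHaar Γ)) := by
  have hin : ∀ g h : Γ, inner ℂ (characterL2 g) (characterL2 h) =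
      ∫ ξ, pairing (g - h) ξ ∂(dualHaar Γ) := fun g h => by
    rw [characterL2, characterL2, ContinuousMap.inner_toLp]
    refine integral_congr_ae (ae_of_all _ fun ξ => ?_)
    simp [conjCharacter, pairing, ofAdd_sub, div_eq_mul_inv, mul_comm,
      ← Circle.coe_inv_eq_conj]
  have hself : ∀ g : Γ, inner ℂ (characterL2 g) (characterL2 g) = (1 : ℂ) := fun g => by
    rw [hin]
    simp [pairing]
  refine ⟨fun g => ?_, fun g h hgh => ?_⟩
  · have h1 := inner_self_eq_norm_sq_to_K (𝕜 := ℂ) (characterL2 g)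
    rw [hself] at h1
    have h2 : ‖characterL2 g‖ ^ 2 = 1 := by
      rw [← Complex.ofReal_inj]
      push_cast
      exact h1.symm
    exact (pow_eq_one_iff_of_nonneg (norm_nonneg _) two_ne_zero).1 h2
  · change inner ℂ (characterL2 g) (characterL2 h) = 0
    obtain ⟨η, hη⟩ := exists_pairing_ne_one (sub_ne_zero.2 hgh)
    rw [hin]
    have h1 := integral_mul_left_eq_self (μ := dualHaar Γ) (fun ξ => pairing (g - h) ξ) η
    have h2 : ∀ ξ, pairing (g - h) (η * ξ) = pairing (g - h) η * pairing (g - h) ξ := fun ξ =>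
      congrArg (fun z : Circle => (z : ℂ)) (ContinuousMonoidHom.mul_apply η ξ _)
    simp only [h2] at h1
    rw [integral_const_mul] at h1
    have h3 : (pairing (g - h) η - 1) * ∫ ξ, pairing (g - h) ξ ∂(dualHaar Γ) = 0 := by
      rw [sub_mul, h1, one_mul, sub_self]
    exact (mul_eq_zero.1 h3).resolve_left (sub_ne_zero.2 hη)

/-- The Fourier (Plancherel) transform `ℓ²(Γ) → L²(Γ̂)`, `a ↦ ∑ h, a(h) conj (h, ·)`, the series
being convergent in `L²(Γ̂)`: the isometric extension to `ℓ²(Γ)` of the Fourier transform on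
`ℓ¹(Γ)`; see `fourier_of_summable`. -/
def fourier [DiscreteTopology Γ] : EllTwo Γ →ₗᵢ[ℂ] Lp ℂ 2 (dualHaar Γ) :=
  (orthonormal_characterL2 (Γ := Γ)).orthogonalFamily.linearIsometry

theorem hasSum_fourier [DiscreteTopology Γ] (a : EllTwo Γ) :
    HasSum (fun h : Γ => a h • characterL2 h) (fourier a) := by
  have h := (orthonormal_characterL2 (Γ := Γ)).orthogonalFamily.hasSum_linearIsometry a
  simpa [fourier, LinearIsometry.toSpanSingleton_apply] using h

/-- On `ℓ¹(Γ)` the transform is given by the classical formula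
`â(ξ) = ∑ h, a(h) conj (h, ξ)`. -/
theorem fourier_of_summable [DiscreteTopology Γ] (a : EllTwo Γ) (ha : Summable fun h => ‖a h‖) :
    (fourier a : DualGroup Γ → ℂ) =ᵐ[dualHaar Γ] fun ξ => ∑' h : Γ, a h * conj (pairing h ξ) := by
  have hs : Summable fun h : Γ => a h • (conjCharacter h : C(DualGroup Γ, ℂ)) := by
    refine Summable.of_norm_bounded ha fun h => ?_
    rw [norm_smul]
    refine mul_le_of_le_one_right (norm_nonneg _) ?_
    refine (ContinuousMap.norm_le _ zero_le_one).2 fun ξ => ?_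
    simp [conjCharacter, pairing, Circle.norm_coe]
  have h1 := hs.hasSum.mapL (ContinuousMap.toLp (E := ℂ) 2 (dualHaar Γ) ℂ)
  have h2 : fourier a = ContinuousMap.toLp (E := ℂ) 2 (dualHaar Γ) ℂ
      (∑' h : Γ, a h • (conjCharacter h : C(DualGroup Γ, ℂ))) := by
    refine (hasSum_fourier a).unique ?_
    simpa [characterL2] using h1
  rw [h2]
  filter_upwards [ContinuousMap.coeFn_toLp (p := 2) (𝕜 := ℂ) (dualHaar Γ)
    (∑' h : Γ, a h • (conjCharacter h : C(DualGroup Γ, ℂ)))] with ξ hξ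
  rw [hξ]
  exact (ContinuousMap.tsum_apply hs ξ).symm

/-- The transfer matrix `Â(ξ) = [â_{m,n}(ξ)]` of a matrix with entries in `ℓ²(Γ)`. -/
def transferMatrix [DiscreteTopology Γ] {κ ι : Type*} (A : Matrix κ ι (EllTwo Γ))
    (ξ : DualGroup Γ) : Matrix κ ι ℂ :=
  Matrix.of fun m n => (fourier (A m n) : DualGroup Γ → ℂ) ξ

/-- The two conditions on the matrix of a stable sampling procedure: its transfer matrix has
entries in `L^∞(Γ̂)`, and `δ_A := ess inf_ξ det [Â(ξ)^* Â(ξ)] > 0`. (The determinant is a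
nonnegative real number.) -/
structure IsStableMatrix [DiscreteTopology Γ] {κ ι : Type*} [Fintype κ] [Fintype ι]
    [DecidableEq ι] (A : Matrix κ ι (EllTwo Γ)) : Prop where
  memLp_top : ∀ m n, MemLp (fourier (A m n) : DualGroup Γ → ℂ) ∞ (dualHaar Γ)
  essInf_det_pos : 0 < essInf
    (fun ξ : DualGroup Γ => ((transferMatrix A ξ)ᴴ * transferMatrix A ξ).det.re) (dualHaar Γ)

/-- Matrix convolution: `(A ∗ x)_m(t) = ∑ n, (a_{m,n} ∗ x_n)(t)`, with
`(a ∗ x)(t) = ∑ s, a(t - s) x(s)`. -/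
def matrixConv {κ ι : Type*} [Fintype ι] (A : Matrix κ ι (EllTwo Γ)) (x : ι → EllTwo Γ)
    (m : κ) (t : Γ) : ℂ :=
  ∑ n, ∑' s : Γ, A m n (t - s) * x n s

end Fourier

/-! ## Unitary representations, frames and Riesz sequences -/

/-- A (weakly continuous) unitary representation of `G` on `E`. -/
structure UnitaryRep (G E : Type*) [AddCommGroup G] [TopologicalSpace G]
    [NormedAddCommGroup E] [InnerProductSpace ℂ E] where
  toFun : G → E ≃ₗᵢ[ℂ] E
  map_zero : ∀ x, toFun 0 x = x
  map_add : ∀ s t x, toFun (s + t) x = toFun s (toFun t x)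
  continuous_inner : ∀ x y : E, Continuous fun t => inner ℂ y (toFun t x)

instance instCoeFunUnitaryRep (G E : Type*) [AddCommGroup G] [TopologicalSpace G]
    [NormedAddCommGroup E] [InnerProductSpace ℂ E] :
    CoeFun (UnitaryRep G E) (fun _ => G → E ≃ₗᵢ[ℂ] E) := ⟨UnitaryRep.toFun⟩

section Frames

variable {E : Type*} [NormedAddCommGroup E] [InnerProductSpace ℂ E]

/-- `ψ : Ω → E` is a continuous frame for `E` with respect to `(Ω, μ)`. -/
structure IsContinuousFrame {Ω : Type*} [MeasurableSpace Ω] (μ : Measure Ω) (ψ : Ω → E) :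
    Prop where
  measurable : ∀ x : E, Measurable fun w => inner ℂ (ψ w) x
  bounds : ∃ a b : ℝ, 0 < a ∧ a ≤ b ∧ ∀ x : E,
    ENNReal.ofReal (a * ‖x‖ ^ 2) ≤ ∫⁻ w, ‖inner ℂ (ψ w) x‖ₑ ^ 2 ∂μ ∧
    ∫⁻ w, ‖inner ℂ (ψ w) x‖ₑ ^ 2 ∂μ ≤ ENNReal.ofReal (b * ‖x‖ ^ 2)

/-- `e` is a Riesz sequence in `E`, i.e. a Riesz basis for its closed linear span. -/
def IsRieszSequence {κ : Type*} (e : κ → E) : Prop :=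
  ∃ a b : ℝ, 0 < a ∧ a ≤ b ∧ ∀ (s : Finset κ) (c : κ → ℂ),
    a * ∑ k ∈ s, ‖c k‖ ^ 2 ≤ ‖∑ k ∈ s, c k • e k‖ ^ 2 ∧
    ‖∑ k ∈ s, c k • e k‖ ^ 2 ≤ b * ∑ k ∈ s, ‖c k‖ ^ 2

/-- `e` is a (discrete) frame for the subspace `V` of `L²(μ)`, with respect to the inner product
`⟨F, S⟩ = ∫ F conj S dμ`. -/
structure IsFrameInL2 {Ω κ : Type*} [MeasurableSpace Ω] (μ : Measure Ω) (V : Set (Ω → ℂ))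
    (e : κ → Ω → ℂ) : Prop where
  memLp : ∀ F ∈ V, MemLp F 2 μ
  mem : ∀ k, e k ∈ V
  bounds : ∃ a b : ℝ, 0 < a ∧ a ≤ b ∧ ∀ F ∈ V,
    ENNReal.ofReal a * ∫⁻ t, ‖F t‖ₑ ^ 2 ∂μ ≤ ∑' k, ‖∫ t, F t * conj (e k t) ∂μ‖ₑ ^ 2 ∧
    ∑' k, ‖∫ t, F t * conj (e k t) ∂μ‖ₑ ^ 2 ≤ ENNReal.ofReal b * ∫⁻ t, ‖F t‖ₑ ^ 2 ∂μ

end Frames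

/-! ## The spaces `ℋ_Φ` and `ℋ_{U,φ,Φ}`, and generalized sampling

Below `j : Γ →+ G` is the inclusion of a subgroup. -/

section Spaces

variable {G E Γ ι : Type*} [AddCommGroup G] [TopologicalSpace G]
  [NormedAddCommGroup E] [InnerProductSpace ℂ E] [AddCommGroup Γ]

/-- The family `U(h) φ_n`, indexed by `(n, h)`. -/
def orbit (U : UnitaryRep G E) (j : Γ →+ G) (Φ : ι → E) (p : ι × Γ) : E := U (j p.2) (Φ p.1)

/-- `f = ∑ n, ∑ h, x_n(h) U(h) φ_n`, with (unconditional) convergence in `E`. -/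
def HasExpansion (U : UnitaryRep G E) (j : Γ →+ G) (Φ : ι → E) (x : ι → EllTwo Γ) (f : E) :
    Prop :=
  HasSum (fun p : ι × Γ => x p.1 p.2 • orbit U j Φ p) f

/-- The subspace `ℋ_Φ` of all `∑ n, ∑ h, x_n(h) U(h) φ_n` with `x_n ∈ ℓ²(Γ)`. -/
def generatedSpace (U : UnitaryRep G E) (j : Γ →+ G) (Φ : ι → E) : Set E :=
  {f | ∃ x : ι → EllTwo Γ, HasExpansion U j Φ x f}

/-- The function `F_f(t) = ⟨f, U(t) φ⟩`. -/
def analysisFun (U : UnitaryRep G E) (ϕ f : E) (t : G) : ℂ := inner ℂ (U t ϕ) f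

/-- The space `ℋ_{U,φ,Φ} = {F_f : f ∈ ℋ_Φ}` of functions on `G`. -/
def rangeSpace (U : UnitaryRep G E) (ϕ : E) (j : Γ →+ G) (Φ : ι → E) : Set (G → ℂ) :=
  analysisFun U ϕ '' generatedSpace U j Φ

open Classical in
/-- The coefficients `x_n ∈ ℓ²(Γ)` with `F = F_f`, `f = ∑ n, ∑ h, x_n(h) U(h) φ_n`, of a function
`F` of `ℋ_{U,φ,Φ}`; they are unique in the situation of interest, see `coefficients_eq`. -/
def coefficients (U : UnitaryRep G E) (ϕ : E) (j : Γ →+ G) (Φ : ι → E) (F : G → ℂ) :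
    ι → EllTwo Γ :=
  if h : ∃ (x : ι → EllTwo Γ) (f : E), HasExpansion U j Φ x f ∧ analysisFun U ϕ f = F
  then h.choose else 0

/-- The generalized samples `ℒ_m F(t) = (A ∗ x)_m(t)`, `t ∈ Γ`, of `F ∈ ℋ_{U,φ,Φ}`, where `x` are
the coefficients of `F`. -/
def sample [Fintype ι] {κ : Type*} (U : UnitaryRep G E) (ϕ : E) (j : Γ →+ G) (Φ : ι → E)
    (A : Matrix κ ι (EllTwo Γ)) (F : G → ℂ) (m : κ) (t : Γ) : ℂ :=
  matrixConv A (coefficients U ϕ j Φ F) m t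

theorem coefficients_eq [MeasurableSpace G] {μ : Measure G} {U : UnitaryRep G E} {ϕ : E}
    (hϕ : IsContinuousFrame μ fun t => U t ϕ) {j : Γ →+ G} {Φ : ι → E}
    (hΦ : IsRieszSequence (orbit U j Φ)) {x : ι → EllTwo Γ} {f : E}
    (hx : HasExpansion U j Φ x f) : coefficients U ϕ j Φ (analysisFun U ϕ f) = x := by
  have hex : ∃ (y : ι → EllTwo Γ) (g : E),
      HasExpansion U j Φ y g ∧ analysisFun U ϕ g = analysisFun U ϕ f := ⟨x, f, hx, rfl⟩
  have hc : coefficients U ϕ j Φ (analysisFun U ϕ f) = hex.choose := dif_pos hex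
  obtain ⟨g, hy, hgf⟩ := hex.choose_spec
  rw [hc]
  generalize hex.choose = y at hy
  have hfg : g = f := by
    obtain ⟨a, b, ha, -, hab⟩ := hϕ.bounds
    have h0 := (hab (g - f)).1
    have hz : ∀ w : G, inner ℂ (U w ϕ) (g - f) = 0 := fun w => by
      rw [inner_sub_right, sub_eq_zero]
      exact congrFun hgf w
    simp only [hz, enorm_zero, ne_eq, OfNat.ofNat_ne_zero, not_false_eq_true, zero_pow,
      lintegral_zero, nonpos_iff_eq_zero, ENNReal.ofReal_eq_zero] at h0
    have h1 : ‖g - f‖ ^ 2 ≤ 0 := by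
      by_contra hcon
      push Not at hcon
      have := mul_pos ha hcon
      linarith
    have h2 : ‖g - f‖ = 0 := by
      have := sq_nonneg ‖g - f‖
      exact pow_eq_zero_iff (two_ne_zero) |>.1 (le_antisymm h1 this)
    exact sub_eq_zero.1 (norm_eq_zero.1 h2)
  subst hfg
  obtain ⟨a, b, ha, -, hab⟩ := hΦ
  have hd : HasSum (fun p : ι × Γ => (y p.1 p.2 - x p.1 p.2) • orbit U j Φ p) 0 := by
    have := HasSum.sub hy hx
    simpa [sub_smul] using this
  have hlim := (hd.norm.pow 2)
  ext n t
  by_contra hne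
  have hpos : 0 < ‖y n t - x n t‖ ^ 2 := by
    have := norm_pos_iff.2 (sub_ne_zero.2 hne)
    positivity
  have hle : a * ‖y n t - x n t‖ ^ 2 ≤ 0 := by
    refine ge_of_tendsto (x := atTop) (by simpa using hlim) ?_
    filter_upwards [eventually_ge_atTop ({(n, t)} : Finset (ι × Γ))] with T hT
    refine le_trans ?_ (hab T fun p => y p.1 p.2 - x p.1 p.2).1
    refine mul_le_mul_of_nonneg_left ?_ ha.le
    exact Finset.single_le_sum (f := fun p : ι × Γ => ‖y p.1 p.2 - x p.1 p.2‖ ^ 2)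
      (fun _ _ => by positivity) (hT (Finset.mem_singleton_self _))
  have := mul_pos ha hpos
  linarith

end Spaces

end

end UnitarySampling

open UnitarySampling

namespace UnitarySampling

noncomputable section

/-! ### Plancherel theory and Fourier multipliers on a discrete abelian group. -/

section Plancherel

variable {Γ : Type*} [AddCommGroup Γ] [TopologicalSpace Γ]

/-! Everything is transported to `ℓ²`. By Plancherel, convolution with `A` is multiplication by the
bounded matrix `Â`. The lower bound on `det (Â^* Â)` and Cramer's rule make `(Â^* Â)⁻¹ Â^*`
essentially bounded, so convolution with `A` has a bounded left inverse `B` that is again a matrix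
of multipliers (`IsStableMatrix.exists_matrixConvOp`). Invertibility of `Â^* Â` at one point already
forces `M ≥ NL`, by rank.

Let `Q` be the synthesis operator of the Riesz sequence. Then `f = Q x = Q B (A x)`, and the
coordinates of `A x` are the samples. Both `B` and `Q` respect translations, so `Q B` sends the
basis vector at `(m, r)` to `U(r) σ_m`. Expanding `A x` in the standard basis gives `f = ∑ ℒ_m F(r)
U(r) σ_m`, hence the formula with `S_m = F_{σ_m}`. Convergence in the Hilbert space becomes uniform
convergence by Cauchy–Schwarz and `L²` convergence by the upper frame bound (`analysisFun_hasSum`).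

The shifts of the `S_m` are the images of the standard basis under the bounded operator `D = T Q B`,
`T` being the analysis operator of the continuous frame. Every `F` is `D y` with `y = A x`
controlled by `‖F‖`, which yields the frame bounds (`isFrameInL2_of_synthesis`). Finally, the
`R`-orbit of the `φ_{nl}` is the `H`-orbit of the `φ_n`, reindexed. -/

theorem pairing_add (s t : Γ) (ξ : DualGroup Γ) :
    pairing (s + t) ξ = pairing s ξ * pairing t ξ := by
  simp [pairing, ofAdd_add]

theorem pairing_neg (s : Γ) (ξ : DualGroup Γ) : pairing (-s) ξ = conj (pairing s ξ) := by
  simp [pairing, ofAdd_neg, ← Circle.coe_inv_eq_conj]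

theorem pairing_sub (s t : Γ) (ξ : DualGroup Γ) :
    pairing (s - t) ξ = pairing s ξ * conj (pairing t ξ) := by
  rw [sub_eq_add_neg, pairing_add, pairing_neg]

variable [DiscreteTopology Γ]

instance instRegularDualHaar : (dualHaar Γ).Regular := by
  unfold dualHaar; infer_instance

/-- The star subalgebra of trigonometric polynomials on the dual group. -/
def characterSubalgebra (Γ : Type*) [AddCommGroup Γ] [TopologicalSpace Γ] [DiscreteTopology Γ] :
    StarSubalgebra ℂ C(DualGroup Γ, ℂ) where
  toSubalgebra := Algebra.adjoin ℂ (Set.range conjCharacter)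
  star_mem' := by
    change Algebra.adjoin ℂ (Set.range (conjCharacter (Γ := Γ))) ≤
      star (Algebra.adjoin ℂ (Set.range conjCharacter))
    refine Algebra.adjoin_le ?_
    rintro - ⟨n, rfl⟩
    refine Algebra.subset_adjoin ⟨-n, ?_⟩
    ext ξ
    simp [conjCharacter, pairing_neg]

/-- Products of characters are characters, so the linear span is already an algebra. -/
theorem toSubmodule_characterSubalgebra :
    Subalgebra.toSubmodule (characterSubalgebra Γ).toSubalgebra =
      Submodule.span ℂ (Set.range conjCharacter) := by
  refine Algebra.adjoin_eq_span_of_subset (R := ℂ) (s := Set.range (conjCharacter (Γ := Γ))) ?_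
  refine Set.Subset.trans ?_ Submodule.subset_span
  intro x hx
  refine Submonoid.closure_induction (fun _ => id) ⟨0, ?_⟩ ?_ hx
  · ext ξ
    simp [conjCharacter, pairing]
  · rintro - - - - ⟨m, rfl⟩ ⟨n, rfl⟩
    refine ⟨m + n, ?_⟩
    ext ξ
    simp [conjCharacter, pairing_add]

theorem separatesPoints_characterSubalgebra : (characterSubalgebra Γ).SeparatesPoints := by
  intro ξ η hne
  by_contra! hcon
  refine hne (DFunLike.ext _ _ fun t => ?_)
  have h1 := hcon (conjCharacter t.toAdd)
    ⟨conjCharacter t.toAdd, Algebra.subset_adjoin ⟨_, rfl⟩, rfl⟩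
  have h2 := (starRingEnd ℂ).injective h1
  exact Subtype.ext h2

/-- Stone–Weierstrass on the compact dual group. -/
theorem span_conjCharacter_closure_eq_top :
    (Submodule.span ℂ (Set.range (conjCharacter (Γ := Γ)))).topologicalClosure = ⊤ := by
  rw [← toSubmodule_characterSubalgebra]
  exact congrArg (Subalgebra.toSubmodule <| StarSubalgebra.toSubalgebra ·)
    (ContinuousMap.starSubalgebra_topologicalClosure_eq_top_of_separatesPoints _
      separatesPoints_characterSubalgebra)

/-- The characters are complete in `L²` of the dual group. -/
theorem span_characterL2_closure_eq_top :
    (Submodule.span ℂ (Set.range (characterL2 (Γ := Γ)))).topologicalClosure = ⊤ := by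
  have h := (ContinuousMap.toLp_denseRange (p := 2) ℂ (dualHaar Γ) ℂ
    (by simp)).topologicalClosure_map_submodule span_conjCharacter_closure_eq_top
  rw [Submodule.map_span] at h
  rw [← Set.range_comp] at h
  exact h

theorem fourier_single [DecidableEq Γ] (h : Γ) :
    fourier (lp.single 2 h (1 : ℂ)) = characterL2 h := by
  simp [fourier, LinearIsometry.toSpanSingleton_apply]

/-- The range of an isometry from a complete space is closed, and this one contains the complete
system of characters. -/
theorem fourier_surjective : Function.Surjective (fourier (Γ := Γ)) := by
  classical
  have h1 : IsClosed (Set.range (fourier (Γ := Γ))) :=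
    (fourier (Γ := Γ)).isometry.isUniformInducing.isComplete_range.isClosed
  have h2 : (Submodule.span ℂ (Set.range (characterL2 (Γ := Γ)))).topologicalClosure ≤
      LinearMap.range (fourier (Γ := Γ)).toLinearMap := by
    refine Submodule.topologicalClosure_minimal _ (Submodule.span_le.2 ?_) h1
    rintro - ⟨h, rfl⟩
    exact ⟨_, fourier_single h⟩
  rw [span_characterL2_closure_eq_top] at h2
  exact fun f => h2 (Submodule.mem_top (x := f))

/-- The Plancherel transform as a unitary operator. -/
def fourierEquiv (Γ : Type*) [AddCommGroup Γ] [TopologicalSpace Γ] [DiscreteTopology Γ] :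
    EllTwo Γ ≃ₗᵢ[ℂ] Lp ℂ 2 (dualHaar Γ) :=
  LinearIsometryEquiv.ofSurjective fourier fourier_surjective

theorem coeFn_characterL2 (h : Γ) :
    (characterL2 h : DualGroup Γ → ℂ) =ᵐ[dualHaar Γ] fun ξ => conj (pairing h ξ) :=
  ContinuousMap.coeFn_toLp (p := 2) (𝕜 := ℂ) (dualHaar Γ) (conjCharacter h)

/-- The Fourier inversion formula on `ℓ²(Γ)`. -/
theorem apply_eq_integral_fourier (a : EllTwo Γ) (t : Γ) :
    a t = ∫ ξ, pairing t ξ * (fourier a : DualGroup Γ → ℂ) ξ ∂(dualHaar Γ) := by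
  classical
  have h1 : inner ℂ (characterL2 t) (fourier a) = a t := by
    rw [← fourier_single, LinearIsometry.inner_map_map, lp.inner_single_left]
    simp
  rw [← h1, L2.inner_def]
  refine integral_congr_ae ?_
  filter_upwards [coeFn_characterL2 t] with ξ hξ
  rw [hξ]
  simp [mul_comm]

/-- The operator on `ℓ²(Γ)` with bounded Fourier multiplier `g`. -/
def convOp (g : Lp ℂ ∞ (dualHaar Γ)) : EllTwo Γ →L[ℂ] EllTwo Γ :=
  ((fourierEquiv Γ).symm.toContinuousLinearEquiv : _ →L[ℂ] EllTwo Γ) ∘L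
    ((ContinuousLinearMap.mul ℂ ℂ).holderL (dualHaar Γ) ∞ 2 2 g) ∘L
    ((fourierEquiv Γ).toContinuousLinearEquiv : EllTwo Γ →L[ℂ] _)

theorem fourier_convOp (g : Lp ℂ ∞ (dualHaar Γ)) (x : EllTwo Γ) :
    (fourier (convOp g x) : DualGroup Γ → ℂ) =ᵐ[dualHaar Γ]
      fun ξ => g ξ * (fourier x : DualGroup Γ → ℂ) ξ := by
  have h1 : fourier (convOp g x) = (ContinuousLinearMap.mul ℂ ℂ).holder 2 g (fourier x) :=
    (fourierEquiv Γ).apply_symm_apply _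
  rw [h1]
  exact (ContinuousLinearMap.mul ℂ ℂ).coeFn_holder g (fourier x)

theorem convOp_single [DecidableEq Γ] (g : Lp ℂ ∞ (dualHaar Γ)) (r t : Γ) :
    convOp g (lp.single 2 r (1 : ℂ)) t = ∫ ξ, pairing (t - r) ξ * g ξ ∂(dualHaar Γ) := by
  rw [apply_eq_integral_fourier]
  refine integral_congr_ae ?_
  filter_upwards [fourier_convOp g (lp.single 2 r (1 : ℂ)), coeFn_characterL2 r] with ξ h1 h2
  rw [h1, fourier_single, h2, pairing_sub]
  ring

/-- Multipliers commute with translations; this is why the reconstruction functions are shifts of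
finitely many. -/
theorem convOp_single_eq_translate [DecidableEq Γ] (g : Lp ℂ ∞ (dualHaar Γ)) (r t : Γ) :
    convOp g (lp.single 2 r (1 : ℂ)) t = convOp g (lp.single 2 0 (1 : ℂ)) (t - r) := by
  rw [convOp_single, convOp_single, sub_zero]

/-- By continuity of the operator and of evaluation at `t`, it suffices to treat basis vectors,
where Fourier inversion gives the kernel `a (t - s)`. -/
theorem convOp_apply {g : Lp ℂ ∞ (dualHaar Γ)} {a : EllTwo Γ}
    (hg : (g : DualGroup Γ → ℂ) =ᵐ[dualHaar Γ] fourier a) (x : EllTwo Γ) (t : Γ) :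
    HasSum (fun s => a (t - s) * x s) (convOp g x t) := by
  classical
  have h1 := (lp.hasSum_single (p := 2) (by simp) x).mapL (convOp g)
  have h2 := h1.mapL (lp.evalCLM ℂ (fun _ : Γ => ℂ) 2 t)
  refine h2.congr_fun fun s => ?_
  have h3 : lp.single (E := fun _ : Γ => ℂ) 2 s (x s) = x s • lp.single 2 s (1 : ℂ) := by
    rw [← lp.single_smul, smul_eq_mul, mul_one]
  have h4 : convOp g (lp.single 2 s (1 : ℂ)) t = a (t - s) := by
    rw [convOp_single, apply_eq_integral_fourier a]
    refine integral_congr_ae ?_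
    filter_upwards [hg] with ξ hξ
    rw [hξ]
  rw [h3, map_smul, map_smul]
  change _ = x s • convOp g (lp.single 2 s (1 : ℂ)) t
  rw [h4, smul_eq_mul, mul_comm]

end Plancherel

/-! ### Matrix functions with essentially bounded entries. -/

section EssentiallyBounded

variable {Ω : Type*} [MeasurableSpace Ω] {μ : Measure Ω}

theorem memLp_top_mul {f g : Ω → ℂ} (hf : MemLp f ∞ μ) (hg : MemLp g ∞ μ) :
    MemLp (fun x => f x * g x) ∞ μ :=
  hg.mul hf

theorem memLp_top_conj {f : Ω → ℂ} (hf : MemLp f ∞ μ) : MemLp (fun x => conj (f x)) ∞ μ :=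
  hf.star

theorem memLp_top_const (c : ℂ) : MemLp (fun _ : Ω => c) ∞ μ :=
  memLp_top_of_bound aestronglyMeasurable_const ‖c‖ (ae_of_all _ fun _ => le_rfl)

theorem memLp_top_prod {ι : Type*} (s : Finset ι) {f : ι → Ω → ℂ}
    (hf : ∀ i ∈ s, MemLp (f i) ∞ μ) : MemLp (fun x => ∏ i ∈ s, f i x) ∞ μ := by
  classical
  induction s using Finset.induction_on with
  | empty => simpa using memLp_top_const 1
  | insert i s hi ih =>
    simp only [Finset.prod_insert hi]
    exact memLp_top_mul (hf i (Finset.mem_insert_self _ _))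
      (ih fun j hj => hf j (Finset.mem_insert_of_mem hj))

theorem memLp_top_matrix_mul {κ ι τ : Type*} [Fintype ι] {A : Ω → Matrix κ ι ℂ}
    {B : Ω → Matrix ι τ ℂ} (hA : ∀ i j, MemLp (fun x => A x i j) ∞ μ)
    (hB : ∀ i j, MemLp (fun x => B x i j) ∞ μ) (i : κ) (j : τ) :
    MemLp (fun x => (A x * B x) i j) ∞ μ := by
  simp only [Matrix.mul_apply]
  exact memLp_finsetSum _ fun k _ => memLp_top_mul (hA i k) (hB k j)

variable {ι : Type*} [Fintype ι] [DecidableEq ι]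

theorem memLp_top_det {P : Ω → Matrix ι ι ℂ} (hP : ∀ i j, MemLp (fun x => P x i j) ∞ μ) :
    MemLp (fun x => (P x).det) ∞ μ := by
  simp only [Matrix.det_apply']
  exact memLp_finsetSum _ fun σ _ => memLp_top_mul (memLp_top_const _)
    (memLp_top_prod _ fun i _ => hP _ _)

theorem memLp_top_adjugate {P : Ω → Matrix ι ι ℂ} (hP : ∀ i j, MemLp (fun x => P x i j) ∞ μ)
    (i j : ι) : MemLp (fun x => (P x).adjugate i j) ∞ μ := by
  simp only [Matrix.adjugate_apply]
  refine memLp_top_det fun k l => ?_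
  -- An adjugate entry is the determinant of `P` with row `j` replaced by a constant basis vector.
  by_cases hk : k = j
  · subst hk
    simpa using memLp_top_const _
  · simpa [Matrix.updateRow_ne hk] using hP k l

/-- Cramer's rule: the adjugate is bounded, and the reciprocal of the determinant is at most `δ⁻¹`
in modulus. -/
theorem memLp_top_inv {P : Ω → Matrix ι ι ℂ} (hP : ∀ i j, MemLp (fun x => P x i j) ∞ μ)
    {δ : ℝ} (hδ : 0 < δ) (hdet : ∀ᵐ x ∂μ, δ ≤ ‖(P x).det‖) (i j : ι) :
    MemLp (fun x => (P x)⁻¹ i j) ∞ μ := by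
  simp only [Matrix.inv_def, Ring.inverse_eq_inv', Matrix.smul_apply, smul_eq_mul]
  refine memLp_top_mul (memLp_top_of_bound ?_ δ⁻¹ ?_) (memLp_top_adjugate hP i j)
  · exact (memLp_top_det hP).aestronglyMeasurable.aemeasurable.inv.aestronglyMeasurable
  · filter_upwards [hdet] with x hx
    rw [norm_inv]
    exact inv_anti₀ hδ hx

end EssentiallyBounded

/-! ### Matrices of multiplier operators. -/

section MatrixConvOp

variable {Γ κ ι : Type*} [AddCommGroup Γ] [TopologicalSpace Γ] [DiscreteTopology Γ] [Fintype ι]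

/-- The matrix of multiplier operators `convOp (g m i)`. -/
def matrixConvOp (g : κ → ι → Lp ℂ ∞ (dualHaar Γ)) : (ι → EllTwo Γ) →L[ℂ] (κ → EllTwo Γ) :=
  ContinuousLinearMap.pi fun m => ∑ i, convOp (g m i) ∘L ContinuousLinearMap.proj i

theorem matrixConvOp_apply (g : κ → ι → Lp ℂ ∞ (dualHaar Γ)) (x : ι → EllTwo Γ) (m : κ) :
    matrixConvOp g x m = ∑ i, convOp (g m i) (x i) := by
  simp [matrixConvOp]

theorem fourier_matrixConvOp (g : κ → ι → Lp ℂ ∞ (dualHaar Γ)) (x : ι → EllTwo Γ) (m : κ) :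
    (fourier (matrixConvOp g x m) : DualGroup Γ → ℂ) =ᵐ[dualHaar Γ]
      fun ξ => ∑ i, g m i ξ * (fourier (x i) : DualGroup Γ → ℂ) ξ := by
  rw [matrixConvOp_apply, map_sum]
  have h1 : ∀ᵐ ξ ∂(dualHaar Γ), ∀ i, fourier (convOp (g m i) (x i)) ξ = _ :=
    ae_all_iff.2 fun i => fourier_convOp (g m i) (x i)
  filter_upwards [h1, Lp.coeFn_finsetSum Finset.univ fun i => fourier (convOp (g m i) (x i))]
    with ξ h2 h3
  rw [h3]
  simp [h2]

end MatrixConvOp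

/-! ### Stable matrices and their bounded left inverses. -/

section StableMatrix

variable {Γ κ ι : Type*} [AddCommGroup Γ] [TopologicalSpace Γ] [DiscreteTopology Γ]
  [Fintype κ] [Fintype ι] [DecidableEq ι] {A : Matrix κ ι (EllTwo Γ)}

open scoped ComplexOrder in
theorem IsStableMatrix.exists_le_norm_det (hA : IsStableMatrix A) :
    ∃ δ : ℝ, 0 < δ ∧ ∀ᵐ ξ ∂(dualHaar Γ),
      δ ≤ ‖((transferMatrix A ξ)ᴴ * transferMatrix A ξ).det‖ := by
  refine ⟨_, hA.essInf_det_pos, ?_⟩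
  -- A real `essInf` is known to be an a.e. lower bound only for functions bounded below; Gram
  -- determinants are nonnegative.
  have hb : IsBoundedUnder (· ≥ ·) (ae (dualHaar Γ)) fun ξ : DualGroup Γ =>
      ((transferMatrix A ξ)ᴴ * transferMatrix A ξ).det.re :=
    isBoundedUnder_of ⟨0, fun ξ => (Complex.nonneg_iff.1
      (Matrix.posSemidef_conjTranspose_mul_self (transferMatrix A ξ)).det_nonneg).1⟩
  filter_upwards [ae_essInf_le hb] with ξ hξ
  exact hξ.trans (Complex.re_le_norm _)

open scoped ComplexOrder in
-- At almost every point the Gram matrix is invertible, so `Â(ξ)` has full column rank; a single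
-- such point suffices.
theorem IsStableMatrix.card_le (hA : IsStableMatrix A) : Fintype.card ι ≤ Fintype.card κ := by
  obtain ⟨δ, hδ, h⟩ := hA.exists_le_norm_det
  obtain ⟨ξ, hξ⟩ := h.exists
  have hu : IsUnit ((transferMatrix A ξ)ᴴ * transferMatrix A ξ) := by
    rw [Matrix.isUnit_iff_isUnit_det, isUnit_iff_ne_zero]
    exact norm_pos_iff.1 (hδ.trans_le hξ)
  have h1 := Matrix.rank_of_isUnit _ hu
  rw [Matrix.rank_conjTranspose_mul_self] at h1
  rw [← h1]
  exact Matrix.rank_le_card_height _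

/-- The witness is the pseudo-inverse `(Â^* Â)⁻¹ Â^*`. -/
theorem IsStableMatrix.exists_leftInverse (hA : IsStableMatrix A) :
    ∃ g : ι → κ → Lp ℂ ∞ (dualHaar Γ), ∀ᵐ ξ ∂(dualHaar Γ), ∀ i j,
      ∑ m, g i m ξ * transferMatrix A ξ m j = (1 : Matrix ι ι ℂ) i j := by
  obtain ⟨δ, hδ, h⟩ := hA.exists_le_norm_det
  have h1 : ∀ m i, MemLp (fun ξ => transferMatrix A ξ m i) ∞ (dualHaar Γ) := hA.memLp_top
  have h2 : ∀ i m, MemLp (fun ξ => (transferMatrix A ξ)ᴴ i m) ∞ (dualHaar Γ) := fun i m =>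
    memLp_top_conj (h1 m i)
  have h3 := fun i m => memLp_top_matrix_mul
    (memLp_top_inv (memLp_top_matrix_mul h2 h1) hδ h) h2 i m
  refine ⟨fun i m => (h3 i m).toLp, ?_⟩
  have h4 : ∀ᵐ ξ ∂(dualHaar Γ), ∀ i m, (h3 i m).toLp _ ξ = _ :=
    ae_all_iff.2 fun i => ae_all_iff.2 fun m => (h3 i m).coeFn_toLp
  filter_upwards [h, h4] with ξ hξ h5 i j
  simp only [h5]
  rw [← Matrix.mul_apply, Matrix.mul_assoc, Matrix.nonsing_inv_mul]
  rw [isUnit_iff_ne_zero]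
  exact norm_pos_iff.1 (hδ.trans_le hξ)

theorem matrixConvOp_leftInverse {g : ι → κ → Lp ℂ ∞ (dualHaar Γ)}
    {a : κ → ι → Lp ℂ ∞ (dualHaar Γ)}
    (h : ∀ᵐ ξ ∂(dualHaar Γ), ∀ i j, ∑ m, g i m ξ * a m j ξ = (1 : Matrix ι ι ℂ) i j)
    (x : ι → EllTwo Γ) : matrixConvOp g (matrixConvOp a x) = x := by
  funext i
  refine fourier.injective (Lp.ext ?_)
  have h1 : ∀ᵐ ξ ∂(dualHaar Γ), ∀ m, fourier (matrixConvOp a x m) ξ = _ :=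
    ae_all_iff.2 fun m => fourier_matrixConvOp a x m
  filter_upwards [h, h1, fourier_matrixConvOp g (matrixConvOp a x) i] with ξ h2 h3 h4
  rw [h4]
  simp only [h3, Finset.mul_sum]
  rw [Finset.sum_comm]
  simp only [← mul_assoc, ← Finset.sum_mul, h2, Matrix.one_apply]
  simp

/-- A stable matrix acts by convolution as a bounded operator which has a bounded left inverse
of the same form. -/
theorem IsStableMatrix.exists_matrixConvOp (hA : IsStableMatrix A) :
    ∃ (a : κ → ι → Lp ℂ ∞ (dualHaar Γ)) (g : ι → κ → Lp ℂ ∞ (dualHaar Γ)),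
      (∀ x m t, matrixConvOp a x m t = matrixConv A x m t) ∧
      ∀ x, matrixConvOp g (matrixConvOp a x) = x := by
  obtain ⟨g, hg⟩ := hA.exists_leftInverse
  have ha : ∀ m i, ((hA.memLp_top m i).toLp _ : DualGroup Γ → ℂ) =ᵐ[dualHaar Γ] fourier (A m i) :=
    fun m i => (hA.memLp_top m i).coeFn_toLp
  refine ⟨fun m i => (hA.memLp_top m i).toLp _, g, fun x m t => ?_,
    matrixConvOp_leftInverse ?_⟩
  · rw [matrixConvOp_apply, lp.coeFn_sum, Finset.sum_apply, matrixConv]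
    exact Finset.sum_congr rfl fun i _ => (convOp_apply (ha m i) (x i) t).tsum_eq.symm
  · have h1 : ∀ᵐ ξ ∂(dualHaar Γ), ∀ m i, (hA.memLp_top m i).toLp _ ξ = _ :=
      ae_all_iff.2 fun m => ae_all_iff.2 fun i => ha m i
    filter_upwards [hg, h1] with ξ h2 h3 i j
    simp only [h3]
    exact h2 i j

end StableMatrix

/-! ### Square-summable families on a product index set. -/

section EllTwo

variable {K ι Γ : Type*}

theorem summable_norm_sq (c : EllTwo K) : Summable fun k => ‖c k‖ ^ 2 := by
  simpa using (lp.hasSum_norm (p := 2) (by simp) c).summable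

theorem hasSum_norm_sq (c : EllTwo K) : HasSum (fun k => ‖c k‖ ^ 2) (‖c‖ ^ 2) := by
  simpa using lp.hasSum_norm (p := 2) (by simp) c

theorem memℓp_two_of_summable {c : K → ℂ} (hc : Summable fun k => ‖c k‖ ^ 2) :
    Memℓp c 2 :=
  memℓp_gen (by simpa using hc)

theorem tsum_enorm_sq (c : EllTwo K) : ∑' k, ‖c k‖ₑ ^ 2 = ‖c‖ₑ ^ 2 := by
  have h1 : ∀ z : ℂ, ‖z‖ₑ ^ 2 = ENNReal.ofReal (‖z‖ ^ 2) := fun z => by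
    rw [ENNReal.ofReal_pow (norm_nonneg _), ofReal_norm]
  simp only [h1]
  rw [← ENNReal.ofReal_tsum_of_nonneg (fun _ => by positivity) (summable_norm_sq c),
    (hasSum_norm_sq c).tsum_eq, ENNReal.ofReal_pow (norm_nonneg _), ofReal_norm]

/-- The restriction of an element of `ℓ²(ι × Γ)` to `{i} × Γ`. -/
def slice (Γ : Type*) (i : ι) : EllTwo (ι × Γ) →L[ℂ] EllTwo Γ :=
  LinearMap.mkContinuous
    { toFun := fun c => ⟨fun t => c (i, t), memℓp_two_of_summable
        ((summable_norm_sq c).comp_injective (Prod.mk_right_injective i))⟩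
      map_add' := fun _ _ => rfl
      map_smul' := fun _ _ => rfl } 1 fun c => by
    rw [one_mul]
    refine (sq_le_sq₀ (norm_nonneg _) (norm_nonneg _)).1 ?_
    exact hasSum_le_inj (fun t : Γ => (i, t)) (Prod.mk_right_injective i)
      (fun _ _ => by positivity) (fun _ => le_rfl)
      (hasSum_norm_sq (K := Γ) ⟨fun t => c (i, t), _⟩) (hasSum_norm_sq c)

theorem slice_injective :
    Function.Injective fun (c : EllTwo (ι × Γ)) (i : ι) => slice Γ i c := fun c d hcd => by
  refine lp.ext (funext fun p => ?_)
  exact congrArg (fun x : ι → EllTwo Γ => x p.1 p.2) hcd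

theorem slice_surjective [Fintype ι] :
    Function.Surjective fun (c : EllTwo (ι × Γ)) (i : ι) => slice Γ i c := fun x => by
  have h1 : Summable fun p : ι × Γ => ‖x p.1 p.2‖ ^ 2 :=
    (summable_prod_of_nonneg fun _ => by positivity).2
      ⟨fun i => summable_norm_sq (x i), Summable.of_finite⟩
  exact ⟨⟨fun p => x p.1 p.2, memℓp_two_of_summable h1⟩, rfl⟩

/-- `ℓ²(ι × Γ)` is the finite power `ℓ²(Γ)^ι`. -/
def sliceEquiv (ι Γ : Type*) [Fintype ι] : EllTwo (ι × Γ) ≃L[ℂ] (ι → EllTwo Γ) :=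
  -- The open mapping theorem supplies continuity of the inverse.
  ContinuousLinearEquiv.ofBijective (ContinuousLinearMap.pi fun i => slice Γ i)
    (LinearMap.ker_eq_bot.2 slice_injective) (LinearMap.range_eq_top.2 slice_surjective)

@[simp]
theorem sliceEquiv_apply [Fintype ι] (c : EllTwo (ι × Γ)) (i : ι) (t : Γ) :
    sliceEquiv ι Γ c i t = c (i, t) := rfl

@[simp]
theorem sliceEquiv_symm_apply [Fintype ι] (x : ι → EllTwo Γ) (p : ι × Γ) :
    (sliceEquiv ι Γ).symm x p = x p.1 p.2 := by
  rw [← sliceEquiv_apply, ContinuousLinearEquiv.apply_symm_apply]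

theorem sliceEquiv_single [Fintype ι] [DecidableEq ι] [DecidableEq Γ] [DecidableEq (ι × Γ)]
    (i : ι) (t : Γ) :
    sliceEquiv ι Γ (lp.single 2 (i, t) (1 : ℂ)) = Pi.single i (lp.single 2 t (1 : ℂ)) := by
  funext i'
  ext t'
  rw [sliceEquiv_apply, lp.single_apply]
  by_cases hi : i' = i
  · subst hi
    rw [Pi.single_eq_same, lp.single_apply]
    simp [Pi.single_apply]
  · rw [Pi.single_eq_of_ne hi]
    simp [hi]

theorem hasSum_map_single [DecidableEq K] {F : Type*} [NormedAddCommGroup F] [NormedSpace ℂ F]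
    (T : EllTwo K →L[ℂ] F) (y : EllTwo K) :
    HasSum (fun k => y k • T (lp.single 2 k (1 : ℂ))) (T y) := by
  refine ((lp.hasSum_single (p := 2) (by simp) y).mapL T).congr_fun fun k => ?_
  have h : lp.single (E := fun _ : K => ℂ) 2 k (y k) = y k • lp.single 2 k (1 : ℂ) := by
    rw [← lp.single_smul, smul_eq_mul, mul_one]
  rw [h, map_smul]

end EllTwo

/-! ### Synthesis operators of Riesz sequences. -/

section Riesz

variable {E K : Type*} [NormedAddCommGroup E] [InnerProductSpace ℂ E]

theorem IsRieszSequence.comp_injective {K' : Type*} {e : K → E} (he : IsRieszSequence e)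
    {v : K' → K} (hv : Function.Injective v) : IsRieszSequence (e ∘ v) := by
  classical
  obtain ⟨a, b, ha, hab, h⟩ := he
  refine ⟨a, b, ha, hab, fun s c => ?_⟩
  -- The coefficients are transported along `v` and extended by zero.
  have h1 := h (s.map ⟨v, hv⟩) (Function.extend v c 0)
  simpa [Finset.sum_map, hv.extend_apply] using h1

/-- The upper Riesz bound gives the Cauchy criterion and boundedness of `Q`; the lower one, passed
to the limit, gives `C = 1/√a`. -/
theorem IsRieszSequence.exists_synthesis [CompleteSpace E] {e : K → E} (he : IsRieszSequence e) :
    ∃ (Q : EllTwo K →L[ℂ] E) (C : ℝ), 0 < C ∧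
      ∀ c, HasSum (fun k => c k • e k) (Q c) ∧ ‖c‖ ≤ C * ‖Q c‖ := by
  obtain ⟨a, b, ha, hab, h⟩ := he
  have hb : 0 < b := ha.trans_le hab
  have hs : ∀ c : EllTwo K, Summable fun k => c k • e k := fun c => by
    rw [summable_iff_vanishing_norm]
    intro ε hε
    obtain ⟨s, hs⟩ := summable_iff_vanishing_norm.1 (summable_norm_sq c) (ε ^ 2 / b)
      (by positivity)
    refine ⟨s, fun t ht => ?_⟩
    have h1 := hs t ht
    rw [Real.norm_of_nonneg (Finset.sum_nonneg fun _ _ => by positivity), lt_div_iff₀' hb] at h1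
    exact (sq_lt_sq₀ (norm_nonneg _) hε.le).1 ((h t c).2.trans_lt h1)
  have hbd : ∀ c : EllTwo K, a * ‖c‖ ^ 2 ≤ ‖∑' k, c k • e k‖ ^ 2 ∧
      ‖∑' k, c k • e k‖ ^ 2 ≤ b * ‖c‖ ^ 2 := fun c =>
    ⟨le_of_tendsto_of_tendsto' ((hasSum_norm_sq c).const_mul a) ((hs c).hasSum.norm.pow 2)
        fun s => (h s c).1,
      le_of_tendsto_of_tendsto' ((hs c).hasSum.norm.pow 2) ((hasSum_norm_sq c).const_mul b)
        fun s => (h s c).2⟩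
  refine ⟨LinearMap.mkContinuous
    { toFun := fun c => ∑' k, c k • e k
      map_add' := fun c d => by
        simp only [lp.coeFn_add, Pi.add_apply, add_smul]
        exact (hs c).tsum_add (hs d)
      map_smul' := fun z c => by
        simp only [lp.coeFn_smul, Pi.smul_apply, smul_assoc, RingHom.id_apply]
        exact (hs c).tsum_const_smul z } (√b) fun c => ?_, (√a)⁻¹, by positivity,
    fun c => ⟨(hs c).hasSum, ?_⟩⟩
  · refine (sq_le_sq₀ (norm_nonneg _) (by positivity)).1 ?_
    rw [mul_pow, Real.sq_sqrt hb.le]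
    exact (hbd c).2
  · rw [← div_eq_inv_mul, le_div_iff₀' (by positivity)]
    refine (sq_le_sq₀ (by positivity) (norm_nonneg _)).1 ?_
    rw [mul_pow, Real.sq_sqrt ha.le]
    exact (hbd c).1

end Riesz

/-! ### Analysis operators of continuous frames, and discrete frames in `L²`. -/

section Analysis

variable {E Ω : Type*} [NormedAddCommGroup E] [InnerProductSpace ℂ E] [MeasurableSpace Ω]
  {μ : Measure Ω}

theorem eLpNorm_two_sq (f : Ω → ℂ) : eLpNorm f 2 μ ^ 2 = ∫⁻ w, ‖f w‖ₑ ^ 2 ∂μ := by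
  have h := eLpNorm_nnreal_pow_eq_lintegral (f := f) (μ := μ) (p := 2) two_ne_zero
  simpa using h

theorem IsContinuousFrame.memLp {ψ : Ω → E} (hψ : IsContinuousFrame μ ψ) (f : E) :
    MemLp (fun w => inner ℂ (ψ w) f) 2 μ := by
  obtain ⟨a, b, -, -, hab⟩ := hψ.bounds
  refine ⟨(hψ.measurable f).aestronglyMeasurable, ?_⟩
  have h1 := (hab f).2.trans_lt ENNReal.ofReal_lt_top
  rw [← eLpNorm_two_sq] at h1
  exact (ENNReal.pow_lt_top_iff.1 h1).resolve_right two_ne_zero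

/-- The two frame bounds say exactly that the analysis operator is bounded and bounded below. -/
theorem IsContinuousFrame.exists_analysis {ψ : Ω → E} (hψ : IsContinuousFrame μ ψ) :
    ∃ (T : E →L[ℂ] Lp ℂ 2 μ) (C : ℝ), 0 < C ∧
      ∀ f, (T f : Ω → ℂ) =ᵐ[μ] (fun w => inner ℂ (ψ w) f) ∧ ‖f‖ ≤ C * ‖T f‖ := by
  obtain ⟨a, b, ha, hab, h⟩ := hψ.bounds
  have hb : 0 < b := ha.trans_le hab
  have hn : ∀ f, ∫⁻ w, ‖inner ℂ (ψ w) f‖ₑ ^ 2 ∂μ =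
      ENNReal.ofReal (‖(hψ.memLp f).toLp‖ ^ 2) := fun f => by
    rw [ENNReal.ofReal_pow (norm_nonneg _), ofReal_norm, Lp.enorm_toLp, eLpNorm_two_sq]
  have hbd : ∀ f, a * ‖f‖ ^ 2 ≤ ‖(hψ.memLp f).toLp‖ ^ 2 ∧
      ‖(hψ.memLp f).toLp‖ ^ 2 ≤ b * ‖f‖ ^ 2 := fun f => by
    have h1 := h f
    rw [hn, ENNReal.ofReal_le_ofReal_iff (by positivity),
      ENNReal.ofReal_le_ofReal_iff (by positivity)] at h1
    exact h1
  refine ⟨LinearMap.mkContinuous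
    { toFun := fun f => (hψ.memLp f).toLp
      map_add' := fun f g => by
        rw [← MemLp.toLp_add]
        exact MemLp.toLp_congr _ _ (ae_of_all _ fun w => inner_add_right _ _ _)
      map_smul' := fun z f => by
        rw [RingHom.id_apply, ← MemLp.toLp_const_smul]
        exact MemLp.toLp_congr _ _ (ae_of_all _ fun w => inner_smul_right _ _ _) } (√b)
    fun f => ?_, (√a)⁻¹, by positivity, fun f => ⟨(hψ.memLp f).coeFn_toLp, ?_⟩⟩
  · refine (sq_le_sq₀ (norm_nonneg _) (by positivity)).1 ?_
    rw [mul_pow, Real.sq_sqrt hb.le]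
    exact (hbd f).2
  · rw [← div_eq_inv_mul, le_div_iff₀' (by positivity)]
    refine (sq_le_sq₀ (by positivity) (norm_nonneg _)).1 ?_
    rw [mul_pow, Real.sq_sqrt ha.le]
    exact (hbd f).1

/-- The image of the standard basis of `ℓ²` under a bounded operator `D` is a frame for a space of
functions `D y` on which `D` has bounded solutions `y`. -/
theorem isFrameInL2_of_synthesis {K : Type*} [DecidableEq K] {V : Set (Ω → ℂ)} {e : K → Ω → ℂ}
    (D : EllTwo K →L[ℂ] Lp ℂ 2 μ) (he : ∀ k, e k ∈ V)
    (hD : ∀ k, (D (lp.single 2 k (1 : ℂ)) : Ω → ℂ) =ᵐ[μ] e k) {C : ℝ} (hC : 0 < C)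
    (hV : ∀ F ∈ V, ∃ y, (D y : Ω → ℂ) =ᵐ[μ] F ∧ ‖y‖ ≤ C * ‖D y‖) : IsFrameInL2 μ V e := by
  -- The upper bound `‖D^*‖²` is enlarged by the lower bound only to make the two visibly ordered.
  refine ⟨fun F hF => ?_, he, (C ^ 2)⁻¹, (C ^ 2)⁻¹ + ‖D.adjoint‖ ^ 2, by positivity,
    le_add_of_nonneg_right (by positivity), fun F hF => ?_⟩
  · obtain ⟨y, hy, -⟩ := hV F hF
    exact (memLp_congr_ae hy).1 (Lp.memLp _)
  obtain ⟨y, hy, hle⟩ := hV F hF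
  -- The frame coefficients of `F = D y` are the coordinates of `D^* F`.
  have h1 : ∀ k, ∫ t, F t * conj (e k t) ∂μ = D.adjoint (D y) k := fun k => by
    have h2 : inner ℂ (lp.single 2 k (1 : ℂ)) (D.adjoint (D y)) = D.adjoint (D y) k := by
      rw [lp.inner_single_left]
      simp
    rw [← h2, ContinuousLinearMap.adjoint_inner_right, L2.inner_def]
    refine integral_congr_ae ?_
    filter_upwards [hy, hD k] with t h3 h4
    rw [h3, h4]
    simp
  have h5 : ∫⁻ t, ‖F t‖ₑ ^ 2 ∂μ = ENNReal.ofReal (‖D y‖ ^ 2) := by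
    rw [ENNReal.ofReal_pow (norm_nonneg _), ofReal_norm, Lp.enorm_def, eLpNorm_two_sq]
    refine lintegral_congr_ae ?_
    filter_upwards [hy] with t ht
    rw [ht]
  simp only [h1]
  rw [tsum_enorm_sq, h5, ← ofReal_norm, ← ENNReal.ofReal_pow (norm_nonneg _),
    ← ENNReal.ofReal_mul (by positivity), ← ENNReal.ofReal_mul (by positivity)]
  -- From `‖D y‖² = ⟨D^* D y, y⟩ ≤ ‖D^* D y‖ · C ‖D y‖`, cancelling one factor `‖D y‖`.
  have h6 : ‖D y‖ ≤ C * ‖D.adjoint (D y)‖ := by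
    rcases (norm_nonneg (D y)).eq_or_lt with h0 | h0
    · rw [← h0]
      positivity
    refine le_of_mul_le_mul_right ?_ h0
    calc ‖D y‖ * ‖D y‖ = ‖inner ℂ (D.adjoint (D y)) y‖ := by
          rw [ContinuousLinearMap.adjoint_inner_left, inner_self_eq_norm_sq_to_K]
          simp [sq]
      _ ≤ ‖D.adjoint (D y)‖ * ‖y‖ := norm_inner_le_norm _ _
      _ ≤ ‖D.adjoint (D y)‖ * (C * ‖D y‖) := by gcongr
      _ = C * ‖D.adjoint (D y)‖ * ‖D y‖ := by ring
  constructor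
  · refine ENNReal.ofReal_le_ofReal ?_
    rw [inv_mul_le_iff₀ (by positivity), ← mul_pow]
    gcongr
  · refine ENNReal.ofReal_le_ofReal ?_
    calc ‖D.adjoint (D y)‖ ^ 2 ≤ (‖D.adjoint‖ * ‖D y‖) ^ 2 := by
          gcongr
          exact D.adjoint.le_opNorm _
      _ = ‖D.adjoint‖ ^ 2 * ‖D y‖ ^ 2 := mul_pow _ _ _
      _ ≤ _ := by
          gcongr
          exact le_add_of_nonneg_left (by positivity)

end Analysis

/-! ### Equivariance, generated spaces and the sampling series. -/

section Representation

variable {G E Γ ι : Type*} [AddCommGroup G] [TopologicalSpace G]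
  [NormedAddCommGroup E] [InnerProductSpace ℂ E] [AddCommGroup Γ]

/-- Unitarity moves a shift of the argument onto the vector. -/
theorem analysisFun_sub (U : UnitaryRep G E) (ϕ f : E) (s r : G) :
    analysisFun U ϕ f (s - r) = analysisFun U ϕ (U r f) s := by
  have h : U s ϕ = U r (U (s - r) ϕ) := by rw [← U.map_add, add_sub_cancel]
  rw [analysisFun, analysisFun, h, LinearIsometryEquiv.inner_map_map]

/-- Square-summable expansions along an orbit are equivariant. -/
theorem synthesis_translate {U : UnitaryRep G E} {j : Γ →+ G} {Φ : ι → E}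
    {Q : EllTwo (ι × Γ) →L[ℂ] E} (hQ : ∀ c, HasSum (fun p => c p • orbit U j Φ p) (Q c))
    {c d : EllTwo (ι × Γ)} {r : Γ} (hd : ∀ i t, d (i, t) = c (i, t - r)) :
    Q d = U (j r) (Q c) := by
  have h1 := (hQ c).mapL ((U (j r)).toContinuousLinearEquiv : E →L[ℂ] E)
  have h2 := ((Equiv.refl ι).prodCongr (Equiv.addRight r)).hasSum_iff.2 (hQ d)
  refine h2.unique (h1.congr_fun fun p => ?_)
  have h3 : orbit U j Φ (p.1, p.2 + r) = U (j r) (orbit U j Φ p) := by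
    rw [orbit, orbit, ← U.map_add, ← map_add, add_comm]
  have h4 : d (p.1, p.2 + r) = c p := by rw [hd, add_sub_cancel_right]
  change d (p.1, p.2 + r) • orbit U j Φ (p.1, p.2 + r) = U (j r) (c p • orbit U j Φ p)
  rw [h3, h4, map_smul]

theorem mem_generatedSpace_iff [Fintype ι] {U : UnitaryRep G E} {j : Γ →+ G} {Φ : ι → E} {f : E} :
    f ∈ generatedSpace U j Φ ↔
      ∃ c : EllTwo (ι × Γ), HasSum (fun p => c p • orbit U j Φ p) f := by
  constructor
  · rintro ⟨x, hx⟩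
    refine ⟨(sliceEquiv ι Γ).symm x, ?_⟩
    exact hx.congr_fun fun p => by rw [sliceEquiv_symm_apply]
  · rintro ⟨c, hc⟩
    exact ⟨sliceEquiv ι Γ c, hc⟩

/-- The generated space depends only on the orbit as a set without repetitions. -/
theorem generatedSpace_eq_of_orbit_eq {Γ' ι' : Type*} [AddCommGroup Γ'] [Fintype ι] [Fintype ι']
    {U : UnitaryRep G E} {j : Γ →+ G} {j' : Γ' →+ G} {Φ : ι → E} {Φ' : ι' → E}
    (v : ι' × Γ' ≃ ι × Γ) (hv : ∀ p, orbit U j' Φ' p = orbit U j Φ (v p)) :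
    generatedSpace U j' Φ' = generatedSpace U j Φ := by
  ext f
  rw [mem_generatedSpace_iff, mem_generatedSpace_iff]
  constructor
  · rintro ⟨c, hc⟩
    refine ⟨⟨fun p => c (v.symm p), memℓp_two_of_summable
      ((summable_norm_sq c).comp_injective v.symm.injective)⟩, ?_⟩
    refine v.hasSum_iff.1 (hc.congr_fun fun p => ?_)
    simp [hv]
  · rintro ⟨c, hc⟩
    refine ⟨⟨fun p => c (v p), memℓp_two_of_summable
      ((summable_norm_sq c).comp_injective v.injective)⟩, ?_⟩
    refine (v.hasSum_iff.2 hc).congr_fun fun p => ?_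
    simp [hv]

variable [MeasurableSpace G] {μ : Measure G}

/-- Convergence of the sampling series: if `f = ∑ k, y k • σ k` in `E`, then the corresponding
functions converge pointwise, uniformly and in `L²`. -/
theorem analysisFun_hasSum {U : UnitaryRep G E} {ϕ : E}
    (hϕ : IsContinuousFrame μ fun t => U t ϕ) {K : Type*} {y : K → ℂ} {σ : K → E} {f : E}
    (hf : HasSum (fun k => y k • σ k) f) :
    (∀ s, HasSum (fun k => y k * analysisFun U ϕ (σ k) s) (analysisFun U ϕ f s)) ∧
    TendstoUniformly (fun (T : Finset K) s => ∑ k ∈ T, y k * analysisFun U ϕ (σ k) s)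
      (analysisFun U ϕ f) atTop ∧
    Tendsto (fun T : Finset K =>
      eLpNorm (fun s => analysisFun U ϕ f s - ∑ k ∈ T, y k * analysisFun U ϕ (σ k) s) 2 μ)
      atTop (𝓝 0) := by
  have hd : ∀ (T : Finset K) s, analysisFun U ϕ f s - ∑ k ∈ T, y k * analysisFun U ϕ (σ k) s =
      inner ℂ (U s ϕ) (f - ∑ k ∈ T, y k • σ k) := fun T s => by
    simp [analysisFun]
  have h0 : Tendsto (fun T : Finset K => f - ∑ k ∈ T, y k • σ k) atTop (𝓝 0) := by
    simpa using (tendsto_const_nhds (x := f)).sub hf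
  have h0n : Tendsto (fun T : Finset K => ‖ϕ‖ * ‖f - ∑ k ∈ T, y k • σ k‖) atTop (𝓝 0) := by
    simpa using h0.norm.const_mul ‖ϕ‖
  refine ⟨fun s => ?_, ?_, ?_⟩
  · refine (hf.mapL (innerSL ℂ (U s ϕ))).congr_fun fun k => ?_
    simp [analysisFun]
  · rw [Metric.tendstoUniformly_iff]
    intro ε hε
    filter_upwards [h0n.eventually_lt_const hε] with T hT s
    rw [dist_eq_norm, hd]
    -- Unitarity makes the Cauchy–Schwarz bound independent of `s`.
    refine (norm_inner_le_norm _ _).trans_lt ?_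
    rwa [LinearIsometryEquiv.norm_map]
  · obtain ⟨C, _, _, hC⟩ := hϕ.exists_analysis
    have h1 : Tendsto (fun T : Finset K => ‖C (f - ∑ k ∈ T, y k • σ k)‖ₑ) atTop (𝓝 0) := by
      simpa using ((C.continuous.tendsto _).comp h0).enorm
    refine h1.congr fun T => ?_
    rw [Lp.enorm_def, eLpNorm_congr_ae (hC _).1]
    simp only [hd]

/-- The sampling theorem for a group `Γ` of sampling points. -/
theorem exists_sampling_functions [TopologicalSpace Γ] [DiscreteTopology Γ] [CompleteSpace E]
    {κ : Type*} [Fintype κ] [Fintype ι] [DecidableEq ι] {U : UnitaryRep G E} {ϕ : E}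
    (hϕ : IsContinuousFrame μ fun t => U t ϕ) {j : Γ →+ G} {Φ : ι → E}
    (hΦ : IsRieszSequence (orbit U j Φ)) {A : Matrix κ ι (EllTwo Γ)} (hA : IsStableMatrix A) :
    ∃ S : κ → G → ℂ,
      (∀ m, S m ∈ rangeSpace U ϕ j Φ) ∧
      (∀ F ∈ rangeSpace U ϕ j Φ,
        let term : κ × Γ → G → ℂ := fun p s => sample U ϕ j Φ A F p.1 p.2 * S p.1 (s - j p.2)
        (∀ s, HasSum (fun p => term p s) (F s)) ∧
        TendstoUniformly (fun (T : Finset (κ × Γ)) s => ∑ p ∈ T, term p s) F atTop ∧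
        Tendsto (fun T : Finset (κ × Γ) => eLpNorm (fun s => F s - ∑ p ∈ T, term p s) 2 μ)
          atTop (𝓝 0)) ∧
      IsFrameInL2 μ (rangeSpace U ϕ j Φ) (fun (p : κ × Γ) s => S p.1 (s - j p.2)) := by
  classical
  obtain ⟨Q, C₁, hC₁, hQ⟩ := hΦ.exists_synthesis
  obtain ⟨T, C₂, hC₂, hT⟩ := hϕ.exists_analysis
  obtain ⟨a, g, ha, hga⟩ := hA.exists_matrixConvOp
  let A' : EllTwo (ι × Γ) →L[ℂ] EllTwo (κ × Γ) :=
    ((sliceEquiv κ Γ).symm : _ →L[ℂ] EllTwo (κ × Γ)) ∘L matrixConvOp a ∘L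
      (sliceEquiv ι Γ : EllTwo (ι × Γ) →L[ℂ] _)
  let B' : EllTwo (κ × Γ) →L[ℂ] EllTwo (ι × Γ) :=
    ((sliceEquiv ι Γ).symm : _ →L[ℂ] EllTwo (ι × Γ)) ∘L matrixConvOp g ∘L
      (sliceEquiv κ Γ : EllTwo (κ × Γ) →L[ℂ] _)
  have hBA : ∀ c, B' (A' c) = c := fun c => by simp [A', B', hga]
  have hA' : ∀ x (p : κ × Γ), A' ((sliceEquiv ι Γ).symm x) p = matrixConv A x p.1 p.2 :=
    fun x p => by simp [A', ha]
  -- Column `(m, r)` of the left inverse is the translate by `r` of column `(m, 0)`.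
  have hB' : ∀ m r i t, B' (lp.single 2 (m, r) 1) (i, t) =
      B' (lp.single 2 (m, 0) 1) (i, t - r) := fun m r i t => by
    have h1 : ∀ r t, B' (lp.single 2 (m, r) 1) (i, t) = convOp (g i m) (lp.single 2 r 1) t :=
      fun r t => by
        simp only [B', ContinuousLinearMap.comp_apply, ContinuousLinearEquiv.coe_coe,
          sliceEquiv_symm_apply, sliceEquiv_single, matrixConvOp_apply]
        rw [Finset.sum_eq_single m (fun m' _ hm' => by rw [Pi.single_eq_of_ne hm', map_zero])
          (by simp), Pi.single_eq_same]
    rw [h1, h1, convOp_single_eq_translate]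
  clear_value A' B'
  -- The generators of the reconstruction system: `S_m` is the function attached to `σ m`.
  let σ : κ → E := fun m => Q (B' (lp.single 2 (m, 0) 1))
  have hσ : ∀ p : κ × Γ, Q (B' (lp.single 2 p 1)) = U (j p.2) (σ p.1) := fun p =>
    synthesis_translate (fun c => (hQ c).1) (hB' p.1 p.2)
  have hmem : ∀ c, analysisFun U ϕ (Q c) ∈ rangeSpace U ϕ j Φ := fun c =>
    ⟨Q c, mem_generatedSpace_iff.2 ⟨c, (hQ c).1⟩, rfl⟩
  have hS : ∀ p : κ × Γ, (fun s => analysisFun U ϕ (σ p.1) (s - j p.2)) =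
      analysisFun U ϕ (Q (B' (lp.single 2 p 1))) := fun p => by
    funext s
    rw [analysisFun_sub, hσ]
  refine ⟨fun m => analysisFun U ϕ (σ m), fun m => hmem _, ?_, ?_⟩
  · rintro F ⟨f, ⟨x, hx⟩, rfl⟩
    have hf : Q ((sliceEquiv ι Γ).symm x) = f := by
      refine (hQ _).1.unique ?_
      exact hx.congr_fun fun p => by rw [sliceEquiv_symm_apply]
    -- The sampling expansion in the Hilbert space: `f = Q B (A x)`, with `A x` expanded in the
    -- standard basis.
    have h1 := hasSum_map_single (Q ∘L B') (A' ((sliceEquiv ι Γ).symm x))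
    rw [ContinuousLinearMap.comp_apply, hBA, hf] at h1
    have h2 := analysisFun_hasSum hϕ h1
    have h3 : ∀ (p : κ × Γ) s,
        A' ((sliceEquiv ι Γ).symm x) p * analysisFun U ϕ ((Q ∘L B') (lp.single 2 p 1)) s =
        sample U ϕ j Φ A (analysisFun U ϕ f) p.1 p.2 * analysisFun U ϕ (σ p.1) (s - j p.2) :=
      fun p s => by
        rw [sample, coefficients_eq hϕ hΦ hx, hA', ContinuousLinearMap.comp_apply, ← hS]
    simp only [h3] at h2
    exact h2
  · change IsFrameInL2 μ _ fun (p : κ × Γ) s => analysisFun U ϕ (σ p.1) (s - j p.2)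
    rw [funext hS]
    -- The solution is `y = A' c`, bounded through the lower bounds of `Q` and `T`; the `+ 1` keeps
    -- the constant positive even if `A'` vanishes.
    refine isFrameInL2_of_synthesis (C := ‖A'‖ * C₁ * C₂ + 1) (T ∘L Q ∘L B') (fun p => hmem _)
      (fun p => (hT _).1) (by positivity) ?_
    rintro F ⟨f, ⟨x, hx⟩, rfl⟩
    obtain ⟨c, hc⟩ := mem_generatedSpace_iff.1 ⟨x, hx⟩
    obtain rfl : Q c = f := (hQ c).1.unique hc
    refine ⟨A' c, ?_, ?_⟩
    · simp only [ContinuousLinearMap.comp_apply, hBA]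
      exact (hT _).1
    · simp only [ContinuousLinearMap.comp_apply, hBA]
      calc ‖A' c‖ ≤ ‖A'‖ * ‖c‖ := A'.le_opNorm c
        _ ≤ ‖A'‖ * (C₁ * (C₂ * ‖T (Q c)‖)) := by
            gcongr
            refine (hQ c).2.trans ?_
            gcongr
            exact (hT _).2
        _ = (‖A'‖ * C₁ * C₂) * ‖T (Q c)‖ := by ring
        _ ≤ _ := by
            gcongr
            linarith

end Representation

/-! ### Coset decomposition. -/

section Cosets

/-- Decomposition of a group into cosets of a subgroup, given representatives. -/
def cosetEquiv {H ι : Type*} [AddCommGroup H] (R : AddSubgroup H) {τ : Type*} (h : τ → H)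
    (hh : ∀ x : H, ∃! l, x - h l ∈ R) : (ι × τ) × R ≃ ι × H :=
  Equiv.ofBijective (fun p => (p.1.1, (p.2 : H) + h p.1.2)) <| by
    constructor
    · rintro ⟨⟨i, l⟩, r⟩ ⟨⟨i', l'⟩, r'⟩ he
      obtain ⟨rfl, h2⟩ := Prod.mk.inj he
      obtain rfl : l = l' := (hh ((r : H) + h l)).unique (by simp) (by
        simp only at h2
        simp [h2])
      simpa using h2
    · rintro ⟨i, x⟩
      obtain ⟨l, hl, -⟩ := hh x
      exact ⟨((i, l), ⟨_, hl⟩), by simp⟩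

end Cosets

end

end UnitarySampling

/-! ### The sampling theorem for a subgroup of finite index. -/

theorem corollary3
    {G : Type*} [AddCommGroup G] [TopologicalSpace G] [IsTopologicalAddGroup G]
    [LocallyCompactSpace G] [T2Space G] [MeasurableSpace G] [BorelSpace G]
    (μ : Measure G) [μ.IsAddHaarMeasure] [μ.Regular]
    {E : Type*} [NormedAddCommGroup E] [InnerProductSpace ℂ E] [CompleteSpace E]
    [TopologicalSpace.SeparableSpace E]
    (U : UnitaryRep G E) (ϕ : E) (hϕ : IsContinuousFrame μ fun t => U t ϕ)
    (H : AddSubgroup G) [Countable H] [DiscreteTopology H]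
    (N : ℕ) (Φ : Fin N → E) (hΦ : IsRieszSequence (orbit U H.subtype Φ))
    (R : AddSubgroup H) (L : ℕ) (hL : R.index = L)
    (h : Fin L → H) (hh : ∀ x : H, ∃! l, x - h l ∈ R)
    (M : ℕ) (A : Matrix (Fin M) (Fin N × Fin L) (EllTwo R)) (hA : IsStableMatrix A) :
    N * L ≤ M ∧
    ∃ S : Fin M → G → ℂ,
      (∀ m, S m ∈ rangeSpace U ϕ H.subtype Φ) ∧
      (∀ F ∈ rangeSpace U ϕ H.subtype Φ,
        let term : Fin M × R → G → ℂ := fun p s =>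
          sample U ϕ (H.subtype.comp R.subtype) (fun q : Fin N × Fin L => U (h q.2) (Φ q.1))
            A F p.1 p.2 * S p.1 (s - ((p.2 : H) : G))
        (∀ s, HasSum (fun p => term p s) (F s)) ∧
        TendstoUniformly (fun (T : Finset (Fin M × R)) s => ∑ p ∈ T, term p s) F atTop ∧
        Tendsto (fun T : Finset (Fin M × R) => eLpNorm (fun s => F s - ∑ p ∈ T, term p s) 2 μ)
          atTop (𝓝 0)) ∧
      IsFrameInL2 μ (rangeSpace U ϕ H.subtype Φ)
        (fun (p : Fin M × R) s => S p.1 (s - ((p.2 : H) : G))) := by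
  -- Since `U(r) U(h_l) = U(r + h_l)`, the two orbits agree up to the coset bijection, so the Riesz
  -- property and the generated space carry over.
  have hv : ∀ p : (Fin N × Fin L) × R,
      orbit U (H.subtype.comp R.subtype) (fun q : Fin N × Fin L => U (h q.2) (Φ q.1)) p =
        orbit U H.subtype Φ (cosetEquiv R h hh p) := fun p => by
    exact (U.map_add _ _ _).symm
  have hΨ : IsRieszSequence
      (orbit U (H.subtype.comp R.subtype) fun q : Fin N × Fin L => U (h q.2) (Φ q.1)) := by
    rw [funext hv]
    exact hΦ.comp_injective (cosetEquiv R h hh).injective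
  refine ⟨by simpa using hA.card_le, ?_⟩
  have h1 := exists_sampling_functions hϕ hΨ hA
  rw [rangeSpace, generatedSpace_eq_of_orbit_eq (cosetEquiv R h hh) hv] at h1
  exact h1
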